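/- **Setup.** Let $X$ be a CW-complex of dimension at most $2$ with finitely many 2-cells (*pixels*, forming the set $\Pi$), in which each pixel is bounded by a set of exactly four 1-cells (*edges*) and every edge lies on the boundary of at most two pixels; an edge lying on the boundary of two distinct pixels *joins* them. Let $\pi\colon\Pi\to(\mathbb Z/2)^n$ be a picture and $\|\cdot\|$ a norm on the additive group $(\mathbb Z/2)^n$. An edge $e$ joining pixels $p,q$ has weight $\delta(e)=\|\pi(q)-\pi(p)\|$. Let $N$ be an integer with $\delta(e)\le N$ for every edge $e$ that joins two pixels. For $A\subseteq\Pi$ write $A^*=\Pi\smallsetminus A$, let $\partial A$ be the set of edges joining a pixel in $A$ to one in $A^*$, and put $|A|=\sum_{e\in\partial A}(N-\delta(e))$. Subsets of $\Pi$ are ordered by $A\le B:\Leftrightarrow A\supseteq B$, and $\vec S_k=\{A\subseteq\Pi: |A|<k\}$ for integers $k>0$. A set $O$ of subsets of $\Pi$ is *consistent* if there are no $A,B$ with $\{A,A^*\}\ne\{B,B^*\}$, $A<B$ and $A^*,B\in O$. An *orientation* of a set $\vec S\subseteq 2^\Pi$ closed under ${}^*$ is a subset of $\vec S$ containing exactly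 one element of each pair $\{A,A^*\}\subseteq\vec S$. A *$k$-profile* is a consistent orientation $P$ of $\vec S_k$ such that $A^*\cup B^*\notin P$ for all $A,B\in P$ and which is regular, that is, $\emptyset\notin P$. It is *focused* if $\{p\}\in P$ for some pixel $p$, and it *induces* the $\ell$-profile $P\cap\vec S_\ell$ for $\ell\le k$. Two profiles are *equivalent* if, for a suitable naming of them as $P,Q$, $P$ is a $k$-profile and $Q$ an $\ell$-profile with $\ell\le k$, and every $k'$-profile with $\ell\le k'\le k$ that induces $Q$ is induced by $P$. A *region* is an equivalence class of profiles containing no focused profile; its *complexity* is the least $k$ such that it contains a $k$-profile. Two regions are *distinguishable* if they contain profiles $P,Q$, respectively, with $P\not\subseteq Q$ and $Q\not\subseteq P$. A *line* is a pair $\ell=\{A,A^*\}$ with $\emptyset\ne A\ne\Pi$, of order $|\ell|=|A|$. It *separates* regions $\rho,\rho'$ if for all $P\in\rho$, $P'\in\rho'$ one of $A,A^*$ lies in $P$ and the other in $P'$; it does so *efficiently* if no line of lower order separates $\rho$ from $\rho'$. A set $L$ of lines is *laminar* if any two lines in $L$ have $\subseteq$-comparable elements. Write $\vec L=\bigcup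 L$. A *splitting star* of $L$ is the set of $\le$-maximal elements of a consistent orientation of $\vec L$. The *outline* in $L$ of a region $\rho$ of complexity $k$ is the set of $\le$-maximal elements of $P\cap\vec L$, where $P$ is the unique $k$-profile in $\rho$. **Theorem.** For every non-empty set $R$ of pairwise distinguishable regions of $\pi$ there is a laminar set $L$ of lines such that 1. every two distinct regions in $R$ are efficiently separated by some line in $L$; 2. no proper subset of $L$ separates every two distinct regions in $R$ (efficiently or not); 3. the splitting stars of $L$ are precisely the outlines in $L$ of the regions in $R$. -/

import Mathlib

namespace PictureTangles

open Topology

/-! ### Separations, profiles, regions and lines over a finite set of pixels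

The universe of (oriented) separations is the power set of `V`.  Its ordering is reverse inclusion
(`A ≤ B` in the universe iff `A ⊇ B`), its involution is complementation, its join is `∩` and
its meet is `∪`.  The order function is `ord : Set V → ℝ`. -/

section Universe

variable {V : Type*}

/-- The separation system of all separations of order `< k`. -/
def sepSystem (ord : Set V → ℝ) (k : ℕ) : Set (Set V) := {A | ord A < k}

/-- `O` is an orientation of the separation system `S`: `O ∪ O* = S`, and `O` contains
exactly one orientation of every separation in `S`. -/
def IsOrientation (S O : Set (Set V)) : Prop :=
  O ∪ compl '' O = S ∧ ∀ A ∈ S, (O ∩ {A, Aᶜ}).ncard = 1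

/-- `O` is consistent: there are no distinct unoriented separations `{A, Aᶜ} ≠ {B, Bᶜ}` with
`A < B` in the universe (that is, `B ⊂ A`) such that `Aᶜ` and `B` both lie in `O`. -/
def IsConsistent (O : Set (Set V)) : Prop :=
  ∀ A B : Set V, ({A, Aᶜ} : Set (Set V)) ≠ {B, Bᶜ} → B ⊂ A → ¬ (Aᶜ ∈ O ∧ B ∈ O)

/-- The profile condition: for `A, B ∈ O` the meet of `Aᶜ` and `Bᶜ` is not in `O`. -/
def ProfileCondition (O : Set (Set V)) : Prop :=
  ∀ A ∈ O, ∀ B ∈ O, Aᶜ ∪ Bᶜ ∉ O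

/-- `O` is regular: it contains no separation `A` whose inverse is small (`Aᶜ ≤ A`). -/
def IsRegular (O : Set (Set V)) : Prop := ∀ A ∈ O, ¬ A ⊆ Aᶜ

/-- `P` is a (regular) `k`-profile: `k` is a positive integer and `P` is a regular consistent
orientation of the system of all separations of order `< k` that satisfies the profile
condition. -/
def IsKProfile (ord : Set V → ℝ) (k : ℕ) (P : Set (Set V)) : Prop :=
  0 < k ∧ IsOrientation (sepSystem ord k) P ∧ IsConsistent P ∧ ProfileCondition P ∧ IsRegular P

/-- `P` is a profile in the universe. -/
def IsProfile (ord : Set V → ℝ) (P : Set (Set V)) : Prop := ∃ k, IsKProfile ord k P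

/-- The profile `P` induces the `ℓ`-profile `Q`. -/
def Induces (ord : Set V → ℝ) (ℓ : ℕ) (P Q : Set (Set V)) : Prop := P ∩ sepSystem ord ℓ = Q

/-- `P` is focused: it contains a singleton. -/
def IsFocused (P : Set (Set V)) : Prop := ∃ p : V, {p} ∈ P

/-- One direction of equivalence: `P` is a `k`-profile and `Q` is an `ℓ`-profile for some
`ℓ ≤ k`, and every `k'`-profile with `ℓ ≤ k' ≤ k` that induces `Q` is in turn induced
by `P`. -/
def EquivAbove (ord : Set V → ℝ) (P Q : Set (Set V)) : Prop :=
  ∃ k ℓ : ℕ, ℓ ≤ k ∧ IsKProfile ord k P ∧ IsKProfile ord ℓ Q ∧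
    ∀ k' : ℕ, ℓ ≤ k' → k' ≤ k → ∀ P' : Set (Set V), IsKProfile ord k' P' →
      Induces ord ℓ P' Q → Induces ord k' P P'

/-- Equivalence of profiles. -/
def ProfileEquiv (ord : Set V → ℝ) (P Q : Set (Set V)) : Prop :=
  EquivAbove ord P Q ∨ EquivAbove ord Q P

/-- A region is an equivalence class of profiles that contains no focused profile. -/
def IsRegion (ord : Set V → ℝ) (ρ : Set (Set (Set V))) : Prop :=
  (∃ P, IsProfile ord P ∧ ρ = {Q | ProfileEquiv ord P Q}) ∧ ∀ Q ∈ ρ, ¬ IsFocused Q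

/-- Two regions are distinguishable if they contain profiles neither of which is a subset of
the other. -/
def RegionsDistinguishable (ρ σ : Set (Set (Set V))) : Prop :=
  ∃ P ∈ ρ, ∃ Q ∈ σ, ¬ P ⊆ Q ∧ ¬ Q ⊆ P

/-- A line is an unordered pair `{A, Aᶜ}` with `A` neither empty nor everything. -/
def IsLine (l : Set (Set V)) : Prop :=
  ∃ A : Set V, A ≠ ∅ ∧ A ≠ Set.univ ∧ l = {A, Aᶜ}

/-- `L` is laminar: any two of its members have comparable orientations. -/
def IsLaminar (L : Set (Set (Set V))) : Prop :=
  ∀ l ∈ L, ∀ m ∈ L, ∃ A ∈ l, ∃ B ∈ m, A ⊆ B ∨ B ⊆ A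

/-- The line `l` distinguishes `O` from `O'`: it has an orientation `A ∈ O` with
`Aᶜ ∈ O'`. -/
def Distinguishes (l O O' : Set (Set V)) : Prop :=
  ∃ A : Set V, l = {A, Aᶜ} ∧ A ∈ O ∧ Aᶜ ∈ O'

/-- The line `l` separates the regions `ρ` and `σ`: it distinguishes the profiles in `ρ` from
those in `σ`. -/
def Separates (l : Set (Set V)) (ρ σ : Set (Set (Set V))) : Prop :=
  ∀ P ∈ ρ, ∀ Q ∈ σ, Distinguishes l P Q

/-- The line `l` separates `ρ` and `σ` efficiently: no line that separates them has lower
order. -/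
def EfficientlySeparates (ord : Set V → ℝ) (l : Set (Set V)) (ρ σ : Set (Set (Set V))) : Prop :=
  Separates l ρ σ ∧
    ∀ m, IsLine m → Separates m ρ σ → ∀ A ∈ l, ∀ B ∈ m, ord A ≤ ord B

/-- The maximal elements of `O` in the universe, that is, its inclusion-minimal members. -/
def maximalElements (O : Set (Set V)) : Set (Set V) :=
  {A | A ∈ O ∧ ∀ B ∈ O, B ⊆ A → B = A}

/-- `s` is a splitting star of the set `L` of lines: it is the set of maximal elements of some
consistent orientation of the set `⋃₀ L` of all orientations of lines in `L`. -/
def IsSplittingStar (L : Set (Set (Set V))) (s : Set (Set V)) : Prop :=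
  ∃ O, IsOrientation (⋃₀ L) O ∧ IsConsistent O ∧ s = maximalElements O

/-- `k` is the complexity of `ρ`: the smallest `k` such that `ρ` contains a `k`-profile. -/
def IsComplexity (ord : Set V → ℝ) (ρ : Set (Set (Set V))) (k : ℕ) : Prop :=
  IsLeast {k | ∃ P ∈ ρ, IsKProfile ord k P} k

/-- `s` is the outline in `L` of the region `ρ`: the set of maximal elements of `P ∩ ⋃₀ L`,
where `P` is the `k`-profile in `ρ` for `k` the complexity of `ρ`. -/
def IsOutline (ord : Set V → ℝ) (L : Set (Set (Set V))) (ρ : Set (Set (Set V)))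
    (s : Set (Set V)) : Prop :=
  ∃ k, IsComplexity ord ρ k ∧ ∃ P ∈ ρ, IsKProfile ord k P ∧ s = maximalElements (P ∩ ⋃₀ L)

end Universe

/-! ### Square complexes, pictures and the order function -/

section Picture

variable {X : Type*} [TopologicalSpace X] (C : Set X) [CWComplex C]

/-- The pixels of `C` are its 2-cells. -/
abbrev Pixel := RelCWComplex.cell C 2

/-- The edges of `C` are its 1-cells. -/
abbrev Edge := RelCWComplex.cell C 1

variable {C}

/-- The edge `e` lies on the boundary of the pixel `p`. -/
def OnBoundary (e : Edge C) (p : Pixel C) : Prop :=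
  RelCWComplex.closedCell 1 e ⊆ RelCWComplex.cellFrontier 2 p

variable (C) in
/-- `C` is a flat 2-dimensional cell complex of squares: it has no cells of dimension above 2,
each 2-cell is bounded by a set of exactly four 1-cells, and every 1-cell lies on the boundary
of at most two 2-cells. -/
structure IsFlatSquareComplex : Prop where
  dim_le : ∀ n, 2 < n → IsEmpty (RelCWComplex.cell C n)
  four_edges : ∀ p : Pixel C, {e : Edge C | OnBoundary e p}.ncard = 4
  frontier_eq : ∀ p : Pixel C,
    RelCWComplex.cellFrontier 2 p = ⋃ e ∈ {e : Edge C | OnBoundary e p}, RelCWComplex.closedCell 1 e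
  le_two : ∀ e : Edge C, {p : Pixel C | OnBoundary e p}.encard ≤ 2

/-- The edge `e` joins the two distinct pixels `p` and `q`. -/
def Joins (e : Edge C) (p q : Pixel C) : Prop := p ≠ q ∧ OnBoundary e p ∧ OnBoundary e q

/-- The boundary of a set `A` of pixels: the edges joining a pixel in `A` to one outside. -/
def boundary (A : Set (Pixel C)) : Set (Edge C) := {e | ∃ p q, Joins e p q ∧ p ∈ A ∧ q ∉ A}

variable {n : ℕ}

open Classical in
/-- The weight `‖pic q - pic p‖` of an edge joining two pixels `p` and `q` (and `0` for all other
edges, which lie in no boundary).  It does not depend on the choice made: see `weight_eq`. -/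
noncomputable def weight (ν : AddGroupNorm (Fin n → ZMod 2)) (pic : Pixel C → Fin n → ZMod 2)
    (e : Edge C) : ℝ :=
  if h : ∃ pq : Pixel C × Pixel C, Joins e pq.1 pq.2 then
    ν (pic h.choose.2 - pic h.choose.1) else 0

/-- The order of a set `A` of pixels: the sum of `N - δ(e)` over all edges `e` in its
boundary. -/
noncomputable def order (ν : AddGroupNorm (Fin n → ZMod 2)) (N : ℤ)
    (pic : Pixel C → Fin n → ZMod 2) (A : Set (Pixel C)) : ℝ :=
  ∑ᶠ e ∈ boundary A, ((N : ℝ) - weight ν pic e)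

/-- The weight of an edge is well defined. -/
theorem weight_eq (hC : IsFlatSquareComplex C) (ν : AddGroupNorm (Fin n → ZMod 2))
    (pic : Pixel C → Fin n → ZMod 2) {e : Edge C} {p q : Pixel C} (h : Joins e p q) :
    weight ν pic e = ν (pic q - pic p) := by
  have hex : ∃ pq : Pixel C × Pixel C, Joins e pq.1 pq.2 := ⟨(p, q), h⟩
  unfold weight
  rw [dif_pos hex]
  obtain ⟨hne, h1, h2⟩ := hex.choose_spec
  obtain ⟨hpq, hp, hq⟩ := h
  have key : ∀ r : Pixel C, OnBoundary e r → r = p ∨ r = q := by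
    intro r hr
    by_contra hcon
    rw [not_or] at hcon
    have h3 : ({r, p, q} : Set (Pixel C)).encard = 3 :=
      Set.encard_eq_three.2 ⟨r, p, q, hcon.1, hcon.2, hpq, rfl⟩
    have hsub : ({r, p, q} : Set (Pixel C)) ⊆ {p : Pixel C | OnBoundary e p} := by
      rintro x (rfl | rfl | rfl) <;> assumption
    have h4 := (Set.encard_le_encard hsub).trans (hC.le_two e)
    rw [h3] at h4
    exact absurd h4 (by decide)
  rcases key _ h1 with a | a <;> rcases key _ h2 with b | b
  · exact absurd (a.trans b.symm) hne
  · rw [a, b]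
  · rw [a, b]
    exact map_sub_rev ν _ _
  · exact absurd (a.trans b.symm) hne

/-- The sum defining the order of a set of pixels has finitely many terms. -/
theorem boundary_finite (hC : IsFlatSquareComplex C) [Finite (Pixel C)] (A : Set (Pixel C)) :
    (boundary A).Finite := by
  refine Set.Finite.subset (Set.finite_iUnion (f := fun p : Pixel C => {e | OnBoundary e p})
    fun p => Set.finite_of_ncard_ne_zero (by rw [hC.four_edges p]; decide)) ?_
  rintro e ⟨p, q, h, -, -⟩
  exact Set.mem_iUnion.2 ⟨p, h.2.1⟩

end Picture

end PictureTangles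

open PictureTangles

/-!
Only two properties of the order function matter: it is symmetric under complementation, and it is
submodular (`order_submodular`).  A region is represented by its profile of least order
(`IsRegion.exists_leastProfile`), which is contained in all its other profiles, so that a line
separates two regions as soon as it distinguishes their least profiles.  Regions that are
distinguishable have least profiles that differ on some line.  The theorem thus becomes the
tree-of-tangles theorem for a family of pairwise distinguishable profiles.

*Nested efficient distinguishers.* Lines are chosen in increasing order of their orders. Suppose
that `A` efficiently distinguishes profiles `P` and `Q`, that `B` is an earlier line crossing `A`,
and that `P` and `Q` contain the same side `B`. If `A ∩ B` or `Aᶜ ∩ B` has order at most that of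
`A`, it again distinguishes `P` from `Q` efficiently, and crosses fewer of the earlier lines.
Otherwise, by submodularity (`inter_order_le_or`), the corners `Bᶜ ∩ A` and `Bᶜ ∩ Aᶜ` both have
order less than `B`. They do not distinguish the two profiles that `B` distinguishes efficiently,
so both profiles contain the complements of these corners, and hence also their intersection `B`:
a contradiction (`EffDist.le_or_le`). This gives `exists_nested_distinguishers`.

*Tree structure.* In an inclusion-minimal laminar set `L` of lines distinguishing all pairs of the
family efficiently, every profile `P` determines a consistent orientation of all of `L`, the
up-closure of its own partial orientation (`home`), which has the same maximal elements.
Conversely, every consistent orientation of `L` arises in this way (`exists_home_eq`): otherwise a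
line of largest order in its splitting star could be deleted from `L`. So splitting stars are
outlines. Moreover, for every line in `L` there are two consistent orientations of `L` that differ
only in that line; they come from two profiles of the family, which no other line in `L`
separates.
-/

namespace PictureTangles

section Universe

variable {V : Type*} {ord : Set V → ℝ}

/-! ### Basic properties of profiles -/

theorem IsOrientation.subset {S O : Set (Set V)} (h : IsOrientation S O) : O ⊆ S :=
  fun _ hA => h.1 ▸ Or.inl hA

theorem IsOrientation.mem_or {S O : Set (Set V)} (h : IsOrientation S O) {A : Set V} (hA : A ∈ S) :
    A ∈ O ∨ Aᶜ ∈ O := by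
  rw [← h.1] at hA
  rcases hA with hA | ⟨B, hB, rfl⟩
  · exact Or.inl hA
  · right; rwa [compl_compl]

theorem IsOrientation.compl_notMem {S O : Set (Set V)} (h : IsOrientation S O) {A : Set V}
    (hA : A ∈ O) (hne : A ≠ Aᶜ) : Aᶜ ∉ O := by
  intro hA'
  have h1 := h.2 A (h.subset hA)
  have h2 : O ∩ {A, Aᶜ} = {A, Aᶜ} :=
    Set.inter_eq_right.2 (by rintro x (rfl | rfl) <;> assumption)
  rw [h2, Set.ncard_pair hne] at h1
  omega

/-- A choice of one element from each complementary pair is an orientation. -/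
theorem isOrientation_of {S O : Set (Set V)} (hS : ∀ A ∈ S, Aᶜ ∈ S) (hO : O ⊆ S)
    (hor : ∀ A ∈ S, A ∈ O ∨ Aᶜ ∈ O) (hnot : ∀ A ∈ O, Aᶜ ∉ O) : IsOrientation S O := by
  refine ⟨?_, fun A hA => ?_⟩
  · ext A
    constructor
    · rintro (hA | ⟨B, hB, rfl⟩)
      · exact hO hA
      · exact hS _ (hO hB)
    · intro hA
      rcases hor A hA with h | h
      · exact Or.inl h
      · exact Or.inr ⟨_, h, compl_compl A⟩
  · rw [Set.ncard_eq_one]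
    rcases hor A hA with h | h
    · refine ⟨A, ?_⟩
      ext x
      simp only [Set.mem_inter_iff, Set.mem_insert_iff, Set.mem_singleton_iff]
      constructor
      · rintro ⟨hx, rfl | rfl⟩
        · rfl
        · exact absurd hx (hnot A h)
      · rintro rfl; exact ⟨h, Or.inl rfl⟩
    · refine ⟨Aᶜ, ?_⟩
      ext x
      simp only [Set.mem_inter_iff, Set.mem_insert_iff, Set.mem_singleton_iff]
      constructor
      · rintro ⟨hx, rfl | rfl⟩
        · exact absurd h (hnot _ hx)
        · rfl
      · rintro rfl; exact ⟨h, Or.inr rfl⟩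

namespace IsKProfile

variable {k : ℕ} {P : Set (Set V)} {A B : Set V}

theorem ord_lt (h : IsKProfile ord k P) (hA : A ∈ P) : ord A < k := h.2.1.subset hA

theorem mem_or (h : IsKProfile ord k P) (hA : ord A < k) : A ∈ P ∨ Aᶜ ∈ P := h.2.1.mem_or hA

theorem nonempty (h : IsKProfile ord k P) (hA : A ∈ P) : A.Nonempty := by
  rw [Set.nonempty_iff_ne_empty]
  rintro rfl
  exact h.2.2.2.2 _ hA (Set.empty_subset _)

theorem compl_notMem (h : IsKProfile ord k P) (hA : A ∈ P) : Aᶜ ∉ P :=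
  h.2.1.compl_notMem hA fun he => h.2.2.2.2 A hA he.subset

theorem mem_of_subset (h : IsKProfile ord k P) (hA : A ∈ P) (hAB : A ⊆ B) (hB : ord B < k) :
    B ∈ P := by
  refine (h.mem_or hB).resolve_right fun hB' => ?_
  have hne : A ≠ B := by rintro rfl; exact h.compl_notMem hA hB'
  refine h.2.2.1 B A (fun he => ?_) (hAB.ssubset_of_ne hne) ⟨hB', hA⟩
  have hB2 : B ∈ ({A, Aᶜ} : Set (Set V)) := he ▸ Set.mem_insert _ _
  rcases hB2 with rfl | rfl
  · exact hne rfl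
  · exact h.2.2.2.2 A hA hAB

theorem not_disjoint (hc : ∀ A, ord Aᶜ = ord A) (h : IsKProfile ord k P) (hA : A ∈ P)
    (hB : B ∈ P) : ¬ A ⊆ Bᶜ := fun hAB =>
  h.compl_notMem hB (h.mem_of_subset hA hAB ((hc B).trans_lt (h.ord_lt hB)))

theorem inter_mem (h : IsKProfile ord k P) (hA : A ∈ P) (hB : B ∈ P) (hAB : ord (A ∩ B) < k) :
    A ∩ B ∈ P := by
  refine (h.mem_or hAB).resolve_right fun h' => ?_
  rw [Set.compl_inter] at h'
  exact h.2.2.2.1 A hA B hB h'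

theorem inter_sepSystem_self (h : IsKProfile ord k P) : P ∩ sepSystem ord k = P :=
  Set.inter_eq_left.2 h.2.1.subset

end IsKProfile

theorem sepSystem_mono {k l : ℕ} (h : k ≤ l) : sepSystem ord k ⊆ sepSystem ord l :=
  fun A (hA : ord A < k) => hA.trans_le (Nat.cast_le.2 h)

/-- A `k`-profile induces an `l`-profile for every positive `l ≤ k`. -/
theorem IsKProfile.restrict (hc : ∀ A, ord Aᶜ = ord A) {k l : ℕ} {P : Set (Set V)}
    (h : IsKProfile ord k P) (hl : 0 < l) (hlk : l ≤ k) :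
    IsKProfile ord l (P ∩ sepSystem ord l) := by
  refine ⟨hl, isOrientation_of (fun A (hA : ord A < l) => (hc A).trans_lt hA)
    Set.inter_subset_right (fun A hA => ?_) fun A hA hA' => h.compl_notMem hA.1 hA'.1, ?_, ?_, ?_⟩
  · rcases h.mem_or (sepSystem_mono hlk hA) with h' | h'
    · exact Or.inl ⟨h', hA⟩
    · exact Or.inr ⟨h', (hc A).trans_lt hA⟩
  · exact fun A B hne hBA hAB => h.2.2.1 A B hne hBA ⟨hAB.1.1, hAB.2.1⟩
  · exact fun A hA B hB hAB => h.2.2.2.1 A hA.1 B hB.1 hAB.1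
  · exact fun A hA => h.2.2.2.2 A hA.1

theorem IsKProfile.eq_of_subset {k : ℕ} {P Q : Set (Set V)}
    (hP : IsKProfile ord k P) (hQ : IsKProfile ord k Q) (h : P ⊆ Q) : P = Q := by
  refine h.antisymm fun A hA => ?_
  refine (hP.mem_or (hQ.ord_lt hA)).resolve_right fun h' => ?_
  exact hQ.compl_notMem hA (h h')

/-- A profile determines the separation system that it orients. -/
theorem IsKProfile.sepSystem_eq {k l : ℕ} {P : Set (Set V)}
    (h : IsKProfile ord k P) (h' : IsKProfile ord l P) : sepSystem ord k = sepSystem ord l :=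
  h.2.1.1.symm.trans h'.2.1.1

theorem IsKProfile.congr {k l : ℕ} {P : Set (Set V)} (h : IsKProfile ord k P) (hl : 0 < l)
    (he : sepSystem ord k = sepSystem ord l) : IsKProfile ord l P :=
  ⟨hl, he ▸ h.2.1, h.2.2⟩

/-! ### Regions and their least profiles -/

/-- `EquivAbove ord P Q` at prescribed levels: `P` is a `k`-profile, `Q` an `l`-profile, `l ≤ k`,
and `P` induces all profiles of intermediate level that induce `Q`. -/
def EquivAboveAt (ord : Set V → ℝ) (k l : ℕ) (P Q : Set (Set V)) : Prop :=
  l ≤ k ∧ IsKProfile ord k P ∧ IsKProfile ord l Q ∧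
    ∀ k' : ℕ, l ≤ k' → k' ≤ k → ∀ P' : Set (Set V), IsKProfile ord k' P' →
      Induces ord l P' Q → Induces ord k' P P'

theorem EquivAboveAt.induces {k l : ℕ} {P Q : Set (Set V)} (h : EquivAboveAt ord k l P Q) :
    P ∩ sepSystem ord l = Q :=
  h.2.2.2 l le_rfl h.1 Q h.2.2.1 h.2.2.1.inter_sepSystem_self

theorem EquivAboveAt.refl {k : ℕ} {P : Set (Set V)} (h : IsKProfile ord k P) :
    EquivAboveAt ord k k P P := by
  refine ⟨le_rfl, h, h, fun k' h1 h2 P' hP' hi => ?_⟩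
  obtain rfl : k' = k := le_antisymm h2 h1
  rw [Induces, hP'.inter_sepSystem_self] at hi
  rw [hi]
  exact h.inter_sepSystem_self

/-- The same set may be a profile at several levels; the levels can be exchanged freely. -/
theorem EquivAboveAt.change {k l k₂ l₂ : ℕ} {P Q : Set (Set V)} (h : EquivAboveAt ord k l P Q)
    (hP : IsKProfile ord k₂ P) (hQ : IsKProfile ord l₂ Q) (hle : l₂ ≤ k₂) :
    EquivAboveAt ord k₂ l₂ P Q := by
  have eP := h.2.1.sepSystem_eq hP
  have eQ := h.2.2.1.sepSystem_eq hQ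
  refine ⟨hle, hP, hQ, fun k' h1 h2 P' hP' hi => ?_⟩
  -- clamping `k'` to the interval `[l, k]` does not change the separation system
  have e : sepSystem ord k' = sepSystem ord (max l (min k' k)) := by
    rcases le_total k' l with h3 | h3
    · rw [max_eq_left ((min_le_left _ _).trans h3)]
      exact Set.Subset.antisymm (sepSystem_mono h3) (eQ ▸ sepSystem_mono h1)
    · rcases le_total k' k with h4 | h4
      · rw [min_eq_left h4, max_eq_right h3]
      · rw [min_eq_right h4, max_eq_right h.1]
        refine Set.Subset.antisymm ?_ (sepSystem_mono h4)
        rw [eP]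
        exact sepSystem_mono h2
  have hpos : 0 < max l (min k' k) := h.2.2.1.1.trans_le (le_max_left _ _)
  have := h.2.2.2 _ (le_max_left _ _) (max_le h.1 (min_le_right _ _)) P' (hP'.congr hpos e)
    (by rw [Induces, eQ]; exact hi)
  rw [Induces, ← e] at this
  exact this

theorem EquivAboveAt.trans (hc : ∀ A, ord Aᶜ = ord A) {k l m : ℕ} {P Q T : Set (Set V)}
    (h : EquivAboveAt ord k l P Q) (h' : EquivAboveAt ord l m Q T) : EquivAboveAt ord k m P T := by
  refine ⟨h'.1.trans h.1, h.2.1, h'.2.2.1, fun k' h1 h2 P' hP' hi => ?_⟩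
  rw [Induces] at hi ⊢
  rcases le_total k' l with h3 | h3
  · have h4 := h'.2.2.2 k' h1 h3 P' hP' hi
    rw [Induces, ← h.induces, Set.inter_assoc, Set.inter_eq_right.2 (sepSystem_mono h3)] at h4
    exact h4
  · have hr := hP'.restrict hc h.2.2.1.1 h3
    have h4 := h'.2.2.2 l h'.1 le_rfl _ hr
      (by rw [Induces, Set.inter_assoc, Set.inter_eq_right.2 (sepSystem_mono h'.1), hi])
    rw [Induces, h.2.2.1.inter_sepSystem_self] at h4
    exact h.2.2.2 k' h3 h2 P' hP' h4.symm

/-- Of two profiles that both lie below `P` in the same class, the one of higher level lies above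
the other. -/
theorem EquivAboveAt.of_common {k l m : ℕ} {P Q T : Set (Set V)}
    (h : EquivAboveAt ord k l P Q) (h' : EquivAboveAt ord k m P T) (hml : m ≤ l) :
    EquivAboveAt ord l m Q T := by
  refine ⟨hml, h.2.2.1, h'.2.2.1, fun k' h1 h2 P' hP' hi => ?_⟩
  have h4 := h'.2.2.2 k' h1 (h2.trans h.1) P' hP' hi
  rw [Induces] at h4 ⊢
  rw [← h.induces, Set.inter_assoc, Set.inter_eq_right.2 (sepSystem_mono h2), h4]

/-- `P` is the `k`-profile in `ρ` for `k` the complexity of `ρ`, and all profiles in `ρ` lie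
above it. -/
structure IsLeastProfile (ord : Set V → ℝ) (ρ : Set (Set (Set V))) (k : ℕ) (P : Set (Set V)) :
    Prop where
  complexity : IsComplexity ord ρ k
  mem : P ∈ ρ
  isKProfile : IsKProfile ord k P
  above : ∀ Q ∈ ρ, ∃ l, EquivAboveAt ord l k Q P

theorem IsRegion.exists_leastProfile (hc : ∀ A, ord Aᶜ = ord A) {ρ : Set (Set (Set V))}
    (hρ : IsRegion ord ρ) : ∃ k P, IsLeastProfile ord ρ k P := by
  classical
  obtain ⟨⟨P₀, ⟨k₀, hk₀⟩, hρeq⟩, -⟩ := hρ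
  have hP₀ : P₀ ∈ ρ := by
    rw [hρeq]; exact Or.inl ⟨k₀, k₀, EquivAboveAt.refl hk₀⟩
  have hex : ∃ k, ∃ P ∈ ρ, IsKProfile ord k P := ⟨k₀, P₀, hP₀, hk₀⟩
  obtain ⟨P, hP, hkP⟩ := Nat.find_spec hex
  set k := Nat.find hex with hk
  have hmin : ∀ l, (∃ Q ∈ ρ, IsKProfile ord l Q) → k ≤ l := fun l hl => Nat.find_min' hex hl
  -- the base profile `P₀` of the class lies above `P`
  have base : EquivAboveAt ord k₀ k P₀ P := by
    have h := hP
    rw [hρeq] at h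
    rcases h with ⟨a, b, h⟩ | ⟨a, b, h⟩
    · exact EquivAboveAt.change h hk₀ hkP (hmin _ ⟨_, hP₀, hk₀⟩)
    · have h' : EquivAboveAt ord a b P P₀ := h
      have hb := hmin b ⟨_, hP₀, h'.2.2.1⟩
      obtain rfl : P = P₀ := by
        rw [← h'.induces]
        exact (Set.inter_eq_left.2 (hkP.2.1.subset.trans (sepSystem_mono hb))).symm
      exact (EquivAboveAt.refl hkP).change hk₀ hkP (hmin _ ⟨_, hP₀, hk₀⟩)
  refine ⟨k, P, ⟨⟨P, hP, hkP⟩, fun l hl => hmin l hl⟩, hP, hkP, fun Q hQ => ?_⟩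
  have h := hQ
  rw [hρeq] at h
  rcases h with ⟨a, b, h⟩ | ⟨a, b, h⟩
  · have h' : EquivAboveAt ord a b P₀ Q := h
    have hb := hmin b ⟨_, hQ, h'.2.2.1⟩
    exact ⟨b, h'.of_common (base.change h'.2.1 hkP (hb.trans h'.1)) hb⟩
  · have h' : EquivAboveAt ord a b Q P₀ := h
    exact ⟨a, h'.trans hc (base.change h'.2.2.1 hkP (hmin _ ⟨_, hP₀, h'.2.2.1⟩))⟩

namespace IsLeastProfile

variable {ρ σ : Set (Set (Set V))} {k l : ℕ} {P Q : Set (Set V)}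

theorem subset (h : IsLeastProfile ord ρ k P) (hQ : Q ∈ ρ) : P ⊆ Q := by
  obtain ⟨l, hl⟩ := h.above Q hQ
  rw [← hl.induces]
  exact Set.inter_subset_left

theorem separates_iff (h : IsLeastProfile ord ρ k P) (h' : IsLeastProfile ord σ l Q)
    {m : Set (Set V)} : Separates m ρ σ ↔ Distinguishes m P Q := by
  refine ⟨fun hm => hm P h.mem Q h'.mem, ?_⟩
  rintro ⟨A, rfl, hA, hA'⟩ P' hP' Q' hQ'
  exact ⟨A, rfl, h.subset hP' hA, h'.subset hQ' hA'⟩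

theorem isOutline_iff (h : IsLeastProfile ord ρ k P) {L : Set (Set (Set V))} {s : Set (Set V)} :
    IsOutline ord L ρ s ↔ s = maximalElements (P ∩ ⋃₀ L) := by
  constructor
  · rintro ⟨k', hk', P', hP', hkP', rfl⟩
    obtain rfl := hk'.unique h.complexity
    rw [h.isKProfile.eq_of_subset hkP' (h.subset hP')]
  · rintro rfl
    exact ⟨k, h.complexity, P, h.mem, h.isKProfile, rfl⟩

/-- Otherwise `P ⊆ Q`.  Then every `Q₁ ∈ σ` extends `P`, and since `P` extends uniquely up to the level
of `P₁ ∈ ρ`, one of `P₁` and `Q₁` contains the other. -/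
theorem exists_mem_compl_mem_of_le (hc : ∀ A, ord Aᶜ = ord A) (h : IsLeastProfile ord ρ k P)
    (h' : IsLeastProfile ord σ l Q) (hkl : k ≤ l) {P₁ Q₁ : Set (Set V)} (hP₁ : P₁ ∈ ρ)
    (hQ₁ : Q₁ ∈ σ) (h₁ : ¬ P₁ ⊆ Q₁) (h₂ : ¬ Q₁ ⊆ P₁) : ∃ A ∈ P, Aᶜ ∈ Q := by
  by_contra! hcon
  have hsub : P ⊆ Q := fun A hA =>
    (h'.isKProfile.mem_or (sepSystem_mono hkl (h.isKProfile.ord_lt hA))).resolve_right (hcon A hA)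
  have hQP : Q ∩ sepSystem ord k = P :=
    (h.isKProfile.eq_of_subset (h'.isKProfile.restrict hc h.isKProfile.1 hkl)
      (Set.subset_inter hsub h.isKProfile.2.1.subset)).symm
  obtain ⟨a, ha⟩ := h.above P₁ hP₁
  obtain ⟨b, hb⟩ := h'.above Q₁ hQ₁
  have hQ₁P : Q₁ ∩ sepSystem ord k = P := by
    rw [← hQP, ← hb.induces, Set.inter_assoc, Set.inter_eq_right.2 (sepSystem_mono hkl)]
  rcases le_total b a with hba | hba
  · refine h₂ ?_
    have := ha.2.2.2 b (hkl.trans hb.1) hba Q₁ hb.2.1 hQ₁P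
    rw [← (this : P₁ ∩ sepSystem ord b = Q₁)]
    exact Set.inter_subset_left
  · refine h₁ ?_
    have := ha.2.2.2 a ha.1 le_rfl _ (hb.2.1.restrict hc ha.2.1.1 hba)
      (by rw [Induces, Set.inter_assoc, Set.inter_eq_right.2 (sepSystem_mono ha.1), hQ₁P])
    rw [Induces, ha.2.1.inter_sepSystem_self] at this
    rw [this]
    exact Set.inter_subset_left

theorem exists_mem_compl_mem (hc : ∀ A, ord Aᶜ = ord A) (h : IsLeastProfile ord ρ k P)
    (h' : IsLeastProfile ord σ l Q) (hd : RegionsDistinguishable ρ σ) : ∃ A ∈ P, Aᶜ ∈ Q := by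
  obtain ⟨P₁, hP₁, Q₁, hQ₁, h₁, h₂⟩ := hd
  rcases le_total k l with hkl | hkl
  · exact exists_mem_compl_mem_of_le hc h h' hkl hP₁ hQ₁ h₁ h₂
  · obtain ⟨A, hA, hA'⟩ := exists_mem_compl_mem_of_le hc h' h hkl hQ₁ hP₁ h₂ h₁
    exact ⟨Aᶜ, hA', by rwa [compl_compl]⟩

end IsLeastProfile

/-! ### Nested sets of efficient distinguishers -/

/-- `A` and `B` are nested: the lines `{A, Aᶜ}` and `{B, Bᶜ}` have comparable elements. -/
def Nested (A B : Set V) : Prop := A ⊆ B ∨ A ⊆ Bᶜ ∨ Aᶜ ⊆ B ∨ Aᶜ ⊆ Bᶜ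

theorem Nested.symm {A B : Set V} (h : Nested A B) : Nested B A := by
  unfold Nested at *
  rw [Set.subset_compl_comm (s := B), Set.compl_subset_comm (s := B), Set.compl_subset_compl,
    ← Set.compl_subset_compl (s := A)] at *
  tauto

theorem nested_compl_left {A B : Set V} : Nested Aᶜ B ↔ Nested A B := by
  unfold Nested
  rw [compl_compl]
  tauto

theorem nested_compl_right {A B : Set V} : Nested A Bᶜ ↔ Nested A B := by
  unfold Nested
  rw [compl_compl]
  tauto

theorem nested_inter_right (A B : Set V) : Nested (A ∩ B) B := Or.inl Set.inter_subset_right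

/-- A set nested with two crossing sets is nested with their corners. -/
theorem Nested.inter {A B C : Set V} (hAB : ¬ Nested A B) (hA : Nested A C) (hB : Nested B C) :
    Nested (A ∩ B) C := by
  have key : ∀ D : Set V, Aᶜ ⊆ D → Bᶜ ⊆ Dᶜ → False := fun D h1 h2 =>
    hAB (Or.inr (Or.inr (Or.inl (h1.trans (Set.compl_subset_compl.1 h2)))))
  have both : ∀ D : Set V, Aᶜ ⊆ D → Bᶜ ⊆ D → (A ∩ B)ᶜ ⊆ D := fun D h1 h2 => by
    rw [Set.compl_inter]; exact Set.union_subset h1 h2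
  rcases hA with hA | hA | hA | hA
  · exact Or.inl (Set.inter_subset_left.trans hA)
  · exact Or.inr (Or.inl (Set.inter_subset_left.trans hA))
  all_goals
    rcases hB with hB | hB | hB | hB
    · exact Or.inl (Set.inter_subset_right.trans hB)
    · exact Or.inr (Or.inl (Set.inter_subset_right.trans hB))
  · exact Or.inr (Or.inr (Or.inl (both _ hA hB)))
  · exact (key _ hA hB).elim
  · exact (key _ hA (by rwa [compl_compl])).elim
  · exact Or.inr (Or.inr (Or.inr (both _ hA hB)))

/-- `A` lies in `P` and its complement in `Q`, and `A` has least order among all such sets. -/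
def EffDist (ord : Set V → ℝ) (A : Set V) (P Q : Set (Set V)) : Prop :=
  A ∈ P ∧ Aᶜ ∈ Q ∧ ∀ B ∈ P, Bᶜ ∈ Q → ord A ≤ ord B

theorem EffDist.symm (hc : ∀ A, ord Aᶜ = ord A) {A : Set V} {P Q : Set (Set V)}
    (h : EffDist ord A P Q) : EffDist ord Aᶜ Q P := by
  refine ⟨h.2.1, by rw [compl_compl]; exact h.1, fun B hB hB' => ?_⟩
  rw [hc, ← hc B]
  exact h.2.2 _ hB' (by rwa [compl_compl])

/-- If `B` efficiently distinguishes two profiles `P` and `Q`, then the two parts into which `A`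
divides `Bᶜ` cannot both have order less than `B`. -/
theorem EffDist.le_or_le (hc : ∀ A, ord Aᶜ = ord A) {k l : ℕ} {P Q : Set (Set V)}
    (hP : IsKProfile ord k P) (hQ : IsKProfile ord l Q) {A B : Set V} (hB : EffDist ord B P Q) :
    ord B ≤ ord (A ∪ B) ∨ ord B ≤ ord (Aᶜ ∪ B) := by
  by_contra! h
  have key : ∀ D : Set V, ord (D ∪ B) < ord B → D ∪ B ∈ Q := fun D hD => by
    have hDP := hP.mem_of_subset hB.1 Set.subset_union_right (hD.trans (hP.ord_lt hB.1))
    refine (hQ.mem_or (hD.trans ((hc B).symm.trans_lt (hQ.ord_lt hB.2.1)))).resolve_right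
      fun hDQ => (hB.2.2 _ hDP hDQ).not_gt hD
  have e : (A ∪ B) ∩ (Aᶜ ∪ B) = B := by
    rw [← Set.inter_union_distrib_right, Set.inter_compl_self, Set.empty_union]
  have h3 := hQ.inter_mem (key A h.1) (key Aᶜ h.2)
    (by rw [e]; exact (hc B).symm.trans_lt (hQ.ord_lt hB.2.1))
  rw [e] at h3
  exact hQ.compl_notMem h3 hB.2.1

/-- If `B` efficiently distinguishes some two profiles, then by submodularity the corners `A ∩ B`
and `Aᶜ ∩ B` do not both have order greater than `A`. -/
theorem inter_order_le_or (hc : ∀ A, ord Aᶜ = ord A)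
    (hs : ∀ A B, ord (A ∩ B) + ord (A ∪ B) ≤ ord A + ord B)
    {k l : ℕ} {P Q : Set (Set V)} (hP : IsKProfile ord k P) (hQ : IsKProfile ord l Q)
    {A B : Set V} (hB : EffDist ord B P Q) : ord (A ∩ B) ≤ ord A ∨ ord (Aᶜ ∩ B) ≤ ord A := by
  have h1 := hs A B
  have h2 := hs Aᶜ B
  rw [hc] at h2
  rcases hB.le_or_le hc hP hQ (A := A) with h | h
  · left; linarith
  · right; linarith

/-- An uncrossing step: a corner of `A` and `B` is an efficient distinguisher of `P` and `Q`. -/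
theorem EffDist.uncross (hc : ∀ A, ord Aᶜ = ord A)
    {k l : ℕ} {P Q : Set (Set V)} (hP : IsKProfile ord k P) (hQ : IsKProfile ord l Q)
    {A B : Set V} (hA : EffDist ord A P Q) (hBP : B ∈ P)
    (h : ord (A ∩ B) ≤ ord A) : EffDist ord (A ∩ B) P Q := by
  refine ⟨hP.inter_mem hA.1 hBP (h.trans_lt (hP.ord_lt hA.1)), ?_, fun D hD hD' =>
    h.trans (hA.2.2 D hD hD')⟩
  refine hQ.mem_of_subset hA.2.1 (Set.compl_subset_compl.2 Set.inter_subset_left) ?_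
  rw [hc]
  exact h.trans_lt ((hc A).symm.trans_lt (hQ.ord_lt hA.2.1))

/-- Let `N` be a nested set of separations that efficiently distinguish some profiles, of order
at most that of `A` and not distinguishing `P` from `Q`.  Then `P` and `Q` are efficiently
distinguished by a separation nested with all of `N`. -/
theorem EffDist.exists_nested [Finite V] (hc : ∀ A, ord Aᶜ = ord A)
    (hs : ∀ A B, ord (A ∩ B) + ord (A ∪ B) ≤ ord A + ord B)
    {k l : ℕ} {P Q : Set (Set V)} (hP : IsKProfile ord k P) (hQ : IsKProfile ord l Q)
    {A : Set V} (hA : EffDist ord A P Q) {N : Set (Set V)}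
    (hN : ∀ B ∈ N, ∀ C ∈ N, Nested B C)
    (hN' : ∀ B ∈ N, ord B ≤ ord A ∧ ¬ (B ∈ P ∧ Bᶜ ∈ Q) ∧ ¬ (B ∈ Q ∧ Bᶜ ∈ P) ∧
      ∃ k' l' P' Q', IsKProfile ord k' P' ∧ IsKProfile ord l' Q' ∧ EffDist ord B P' Q') :
    ∃ A', EffDist ord A' P Q ∧ ∀ B ∈ N, Nested A' B := by
  -- an efficient distinguisher crossing the fewest elements of `N`
  obtain ⟨M, hM, hmin⟩ := Set.Finite.exists_minimalFor
    (fun D => {B ∈ N | ¬ Nested D B}) {D | EffDist ord D P Q} (Set.toFinite _) ⟨A, hA⟩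
  refine ⟨M, hM, ?_⟩
  by_contra! hcross
  obtain ⟨B, hBN, hMB⟩ := hcross
  have hMA : ord M = ord A := le_antisymm (hM.2.2 _ hA.1 hA.2.1) (hA.2.2 _ hM.1 hM.2.1)
  obtain ⟨hBA, hB1, hB2, k', l', P', Q', hP', hQ', hB⟩ := hN' B hBN
  -- a corner `D` with the same efficiency crosses fewer elements of `N`
  have contra : ∀ D, EffDist ord D P Q → Nested D B →
      (∀ C, Nested M C → Nested B C → Nested D C) → False := by
    intro D hD hDB hDC
    have h1 := hmin hD (fun C hC => ⟨hC.1, fun h => hC.2 (hDC C h (hN B hBN C hC.1))⟩)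
    exact (h1 ⟨hBN, hMB⟩).2 hDB
  -- `X` is the side of the line through `B` that lies in both `P` and `Q`
  have step : ∀ X, X ∈ P → X ∈ Q → ¬ Nested M X → (∀ D, Nested D X → Nested D B) →
      (∀ C, Nested B C → Nested X C) →
      (ord (M ∩ X) ≤ ord M ∨ ord (Mᶜ ∩ X) ≤ ord M) → False := by
    intro X hXP hXQ hMX h1 h2 hcor
    rcases hcor with h | h
    · exact contra _ (hM.uncross hc hP hQ hXP h) (h1 _ (nested_inter_right _ _))
        fun C hC hC' => Nested.inter hMX hC (h2 C hC')
    · have h' := ((hM.symm hc).uncross hc hQ hP hXQ (by rw [hc M]; exact h)).symm hc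
      refine contra _ h' (nested_compl_left.2 (h1 _ (nested_inter_right _ _)))
        fun C hC hC' => nested_compl_left.2 (Nested.inter ?_ (nested_compl_left.2 hC) (h2 C hC'))
      rwa [nested_compl_left]
  have hkP : ord B < k := hBA.trans_lt (hP.ord_lt hA.1)
  have hlQ : ord B < l := hBA.trans_lt ((hc A).symm.trans_lt (hQ.ord_lt hA.2.1))
  rcases hP.mem_or hkP with hBP | hBP
  · have hBQ := (hQ.mem_or hlQ).resolve_right fun h => hB1 ⟨hBP, h⟩
    exact step B hBP hBQ hMB (fun D h => h) (fun C h => h) (inter_order_le_or hc hs hP' hQ' hB)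
  · have hBQ := (hQ.mem_or hlQ).resolve_left fun h => hB2 ⟨h, hBP⟩
    exact step Bᶜ hBP hBQ (by rwa [nested_compl_right]) (fun D h => nested_compl_right.1 h)
      (fun C h => nested_compl_left.2 h) (inter_order_le_or hc hs hQ' hP' (hB.symm hc))

/-- A family of pairwise distinguishable profiles has a nested set of efficient distinguishers. -/
theorem exists_nested_distinguishers [Finite V] (hc : ∀ A, ord Aᶜ = ord A)
    (hs : ∀ A B, ord (A ∩ B) + ord (A ∪ B) ≤ ord A + ord B)
    {ι : Type*} {k : ι → ℕ} {P : ι → Set (Set V)} (hP : ∀ i, IsKProfile ord (k i) (P i))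
    (hd : ∀ i j, i ≠ j → ∃ A ∈ P i, Aᶜ ∈ P j) :
    ∃ N : Set (Set V), (∀ A ∈ N, ∀ B ∈ N, Nested A B) ∧
      (∀ A ∈ N, ∃ i j, EffDist ord A (P i) (P j)) ∧
      ∀ i j, i ≠ j → ∃ A ∈ N, EffDist ord A (P i) (P j) ∨ EffDist ord A (P j) (P i) := by
  -- The last condition says that `N` has been filled up in increasing order of separations.
  obtain ⟨N, ⟨hN1, hN2, hN3⟩, hmax⟩ := Set.Finite.exists_maximal
    (s := {N : Set (Set V) | (∀ A ∈ N, ∀ B ∈ N, Nested A B) ∧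
      (∀ A ∈ N, ∃ i j, EffDist ord A (P i) (P j)) ∧
      (∀ A ∈ N, ∀ i j B, EffDist ord B (P i) (P j) → ord B < ord A →
        ∃ C ∈ N, EffDist ord C (P i) (P j) ∨ EffDist ord C (P j) (P i))}) (Set.toFinite _)
    ⟨∅, by simp⟩
  refine ⟨N, hN1, hN2, ?_⟩
  by_contra! hcon
  obtain ⟨i₀, j₀, hij₀, hcon₀⟩ := hcon
  -- every pair has some efficient distinguisher
  have heff : ∀ i j, i ≠ j → ∃ A, EffDist ord A (P i) (P j) := by
    intro i j hij
    obtain ⟨A, hA, hA'⟩ := hd i j hij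
    obtain ⟨B, hB, hmin⟩ := Set.Finite.exists_minimalFor ord {A | A ∈ P i ∧ Aᶜ ∈ P j}
      (Set.toFinite _) ⟨A, hA, hA'⟩
    exact ⟨B, hB.1, hB.2, fun C hC hC' =>
      (le_total (ord B) (ord C)).elim id fun h => hmin ⟨hC, hC'⟩ h⟩
  obtain ⟨A₀, hA₀⟩ := heff i₀ j₀ hij₀
  -- `A` has least order among the efficient distinguishers of pairs not yet dealt with by `N`
  obtain ⟨A, ⟨i, j, hA, hcon⟩, hmin⟩ := Set.Finite.exists_minimalFor ord
    {A | ∃ i j, EffDist ord A (P i) (P j) ∧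
      ∀ C ∈ N, ¬ EffDist ord C (P i) (P j) ∧ ¬ EffDist ord C (P j) (P i)}
    (Set.toFinite _) ⟨A₀, i₀, j₀, hA₀, hcon₀⟩
  have hNle : ∀ B ∈ N, ord B ≤ ord A := by
    intro B hB
    by_contra! hlt
    obtain ⟨C, hC, hC'⟩ := hN3 B hB i j A hA hlt
    exact hC'.elim (hcon C hC).1 (hcon C hC).2
  obtain ⟨A', hA', hnest⟩ := hA.exists_nested hc hs (hP i) (hP j) hN1 (fun B hB => by
    refine ⟨hNle B hB, fun h => (hcon B hB).1 ⟨h.1, h.2, fun C hC hC' =>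
      (hNle B hB).trans (hA.2.2 C hC hC')⟩, fun h => (hcon B hB).2 ⟨h.1, h.2, fun C hC hC' =>
      (hNle B hB).trans ((hc A).symm.trans_le ((hA.symm hc).2.2 C hC hC'))⟩, ?_⟩
    obtain ⟨a, b, hab⟩ := hN2 B hB
    exact ⟨_, _, _, _, hP a, hP b, hab⟩)
  have hAA' : ord A' ≤ ord A := hA'.2.2 _ hA.1 hA.2.1
  have hins : insert A' N ⊆ N := hmax (y := insert A' N) (by
    refine ⟨?_, ?_, ?_⟩
    · rintro B (rfl | hB) C (rfl | hC)
      · exact Or.inl subset_rfl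
      · exact hnest C hC
      · exact (hnest B hB).symm
      · exact hN1 B hB C hC
    · rintro B (rfl | hB)
      · exact ⟨i, j, hA'⟩
      · exact hN2 B hB
    · intro B hB a b D hD hDB
      have hlt : ord D < ord A := by
        rcases hB with rfl | hB
        · exact hDB.trans_le hAA'
        · exact hDB.trans_le (hNle B hB)
      by_contra! hno
      refine (hmin (j := D) ⟨a, b, hD, fun C hC => ?_⟩ hlt.le).not_gt hlt
      exact hno C (Set.mem_insert_of_mem _ hC)) (Set.subset_insert _ _)
  exact (hcon A' (hins (Set.mem_insert _ _))).1 hA'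

/-! ### The tree structure of a minimal laminar set of lines -/

/-- The line `l` efficiently distinguishes the profiles `P` and `Q`. -/
def LineEffDist (ord : Set V → ℝ) (l P Q : Set (Set V)) : Prop :=
  ∃ A, l = {A, Aᶜ} ∧ EffDist ord A P Q

theorem LineEffDist.symm (hc : ∀ A, ord Aᶜ = ord A) {l P Q : Set (Set V)}
    (h : LineEffDist ord l P Q) : LineEffDist ord l Q P := by
  obtain ⟨A, rfl, hA⟩ := h
  exact ⟨Aᶜ, by rw [compl_compl, Set.pair_comm], hA.symm hc⟩

theorem IsLine.eq_pair {l : Set (Set V)} (h : IsLine l) {A : Set V} (hA : A ∈ l) :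
    l = {A, Aᶜ} := by
  obtain ⟨B, -, -, rfl⟩ := h
  rcases hA with rfl | rfl
  · rfl
  · rw [compl_compl, Set.pair_comm]

theorem IsLine.compl_mem {l : Set (Set V)} (h : IsLine l) {A : Set V} (hA : A ∈ l) : Aᶜ ∈ l := by
  rw [h.eq_pair hA]; exact Or.inr rfl

theorem IsLine.nonempty_of_mem {l : Set (Set V)} (h : IsLine l) {A : Set V} (hA : A ∈ l) :
    A.Nonempty := by
  obtain ⟨B, h1, h2, rfl⟩ := h
  rcases hA with rfl | rfl
  · exact Set.nonempty_iff_ne_empty.2 h1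
  · exact Set.nonempty_compl.2 h2

theorem ne_compl_of_nonempty {A : Set V} (h : A.Nonempty) : A ≠ Aᶜ := by
  intro he
  obtain ⟨x, hx⟩ := h
  exact (he ▸ hx : x ∈ Aᶜ) hx

theorem pair_compl_eq_iff {A B : Set V} :
    ({A, Aᶜ} : Set (Set V)) = {B, Bᶜ} ↔ A = B ∨ A = Bᶜ := by
  constructor
  · intro h
    exact (h ▸ Set.mem_insert _ _ : A ∈ ({B, Bᶜ} : Set (Set V)))
  · rintro (rfl | rfl)
    · rfl
    · rw [compl_compl, Set.pair_comm]

section Lines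

variable {L : Set (Set (Set V))} (hline : ∀ l ∈ L, IsLine l)

include hline

theorem compl_mem_sUnion {A : Set V} (hA : A ∈ ⋃₀ L) : Aᶜ ∈ ⋃₀ L := by
  obtain ⟨l, hl, hA⟩ := hA
  exact ⟨l, hl, (hline l hl).compl_mem hA⟩

theorem nonempty_of_mem_sUnion {A : Set V} (hA : A ∈ ⋃₀ L) : A.Nonempty := by
  obtain ⟨l, hl, hA⟩ := hA
  exact (hline l hl).nonempty_of_mem hA

theorem pair_mem_of_mem_sUnion {A : Set V} (hA : A ∈ ⋃₀ L) : {A, Aᶜ} ∈ L := by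
  obtain ⟨l, hl, hA⟩ := hA
  rwa [← (hline l hl).eq_pair hA]

theorem IsLaminar.nested (hlam : IsLaminar L) {A B : Set V} (hA : A ∈ ⋃₀ L) (hB : B ∈ ⋃₀ L) :
    Nested A B := by
  obtain ⟨A', hA', B', hB', h⟩ := hlam _ (pair_mem_of_mem_sUnion hline hA) _
    (pair_mem_of_mem_sUnion hline hB)
  have h' : Nested A' B' := by
    rcases h with h | h
    · exact Or.inl h
    · exact Nested.symm (Or.inl h)
  rcases hA' with rfl | rfl <;> rcases hB' with rfl | rfl <;>
    simpa only [nested_compl_left, nested_compl_right] using h'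

/-- For a set of lines, an orientation is consistent if and only if no two of its elements are
disjoint. -/
theorem isConsistent_iff {O : Set (Set V)} (hO : IsOrientation (⋃₀ L) O) :
    IsConsistent O ↔ ∀ A ∈ O, ∀ B ∈ O, ¬ A ⊆ Bᶜ := by
  have hcompl : ∀ A ∈ O, Aᶜ ∉ O := fun A hA =>
    hO.compl_notMem hA (ne_compl_of_nonempty (nonempty_of_mem_sUnion hline (hO.subset hA)))
  constructor
  · intro h A hA B hB hAB
    have hne : A ≠ Bᶜ := by rintro rfl; exact hcompl B hB hA
    have hne' : A ≠ B := by
      rintro rfl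
      obtain ⟨x, hx⟩ := nonempty_of_mem_sUnion hline (hO.subset hA)
      exact hAB hx hx
    refine h Bᶜ A (fun he => ?_) (hAB.ssubset_of_ne hne) ⟨by rwa [compl_compl], hA⟩
    rcases pair_compl_eq_iff.1 he.symm with h | h
    · exact hne h
    · exact hne' (by rwa [compl_compl] at h)
  · intro h A B _ hBA hAB
    exact h B hAB.2 Aᶜ hAB.1 (by rw [compl_compl]; exact hBA.1)

end Lines

theorem exists_maximalElements_subset [Finite V] {O : Set (Set V)} {A : Set V} (hA : A ∈ O) :
    ∃ B ∈ maximalElements O, B ⊆ A := by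
  obtain ⟨B, hB, hmin⟩ := Set.Finite.exists_minimal (s := {B ∈ O | B ⊆ A}) (Set.toFinite _)
    ⟨A, hA, subset_rfl⟩
  exact ⟨B, ⟨hB.1, fun C hC hCB =>
    Set.Subset.antisymm hCB (hmin ⟨hC, hCB.trans hB.2⟩ hCB)⟩, hB.2⟩

/-- The up-closure, in the set of all orientations of lines in `L`, of those that lie in the
profile `P`: the node of the tree at which `P` lives. -/
def home (L : Set (Set (Set V))) (P : Set (Set V)) : Set (Set V) :=
  {B | B ∈ ⋃₀ L ∧ ∃ A ∈ P ∩ ⋃₀ L, A ⊆ B}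

theorem subset_home {L : Set (Set (Set V))} {P : Set (Set V)} : P ∩ ⋃₀ L ⊆ home L P :=
  fun A hA => ⟨hA.2, A, hA, subset_rfl⟩

theorem maximalElements_home (L : Set (Set (Set V))) (P : Set (Set V)) :
    maximalElements (home L P) = maximalElements (P ∩ ⋃₀ L) := by
  ext A
  constructor
  · rintro ⟨⟨hAL, B, hB, hBA⟩, hmin⟩
    obtain rfl := hmin B (subset_home hB) hBA
    exact ⟨hB, fun C hC => hmin C (subset_home hC)⟩
  · rintro ⟨hA, hmin⟩
    refine ⟨subset_home hA, ?_⟩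
    rintro C ⟨hCL, B, hB, hBC⟩ hCA
    obtain rfl := hmin B hB (hBC.trans hCA)
    exact Set.Subset.antisymm hCA hBC

/-- `L` is a laminar set of lines distinguishing every two profiles of the family `P`
efficiently, and each of its lines is the only one in `L` to do so for some two of them. -/
structure IsMinimalDistinguisher {ι : Type*} (ord : Set V → ℝ) (P : ι → Set (Set V))
    (L : Set (Set (Set V))) : Prop where
  isLine : ∀ l ∈ L, IsLine l
  isLaminar : IsLaminar L
  exists_line : ∀ i j, i ≠ j → ∃ l ∈ L, LineEffDist ord l (P i) (P j)
  exists_unique_line : ∀ l ∈ L, ∃ i j, LineEffDist ord l (P i) (P j) ∧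
    ∀ m ∈ L, LineEffDist ord m (P i) (P j) → m = l

theorem exists_isMinimalDistinguisher [Finite V] (hc : ∀ A, ord Aᶜ = ord A)
    (hs : ∀ A B, ord (A ∩ B) + ord (A ∪ B) ≤ ord A + ord B)
    {ι : Type*} {k : ι → ℕ} {P : ι → Set (Set V)} (hP : ∀ i, IsKProfile ord (k i) (P i))
    (hd : ∀ i j, i ≠ j → ∃ A ∈ P i, Aᶜ ∈ P j) : ∃ L, IsMinimalDistinguisher ord P L := by
  obtain ⟨N, hN1, hN2, hN3⟩ := exists_nested_distinguishers hc hs hP hd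
  obtain ⟨L, ⟨hLN, hL⟩, hmin⟩ := Set.Finite.exists_minimal
    (s := {L : Set (Set (Set V)) | L ⊆ (fun A => {A, Aᶜ}) '' N ∧
      ∀ i j, i ≠ j → ∃ l ∈ L, LineEffDist ord l (P i) (P j)}) (Set.toFinite _)
    ⟨_, subset_rfl, fun i j hij => by
      obtain ⟨A, hA, h⟩ := hN3 i j hij
      refine ⟨_, ⟨A, hA, rfl⟩, ?_⟩
      rcases h with h | h
      · exact ⟨A, rfl, h⟩
      · exact LineEffDist.symm hc ⟨A, rfl, h⟩⟩
  refine ⟨L, ?_, ?_, hL, ?_⟩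
  · intro l hl
    obtain ⟨A, hA, rfl⟩ := hLN hl
    obtain ⟨i, j, hij⟩ := hN2 A hA
    exact ⟨A, ((hP i).nonempty hij.1).ne_empty,
      Set.nonempty_compl.1 ((hP j).nonempty hij.2.1), rfl⟩
  · intro l hl m hm
    obtain ⟨A, hA, rfl⟩ := hLN hl
    obtain ⟨B, hB, rfl⟩ := hLN hm
    rcases hN1 A hA B hB with h | h | h | h
    · exact ⟨A, Or.inl rfl, B, Or.inl rfl, Or.inl h⟩
    · exact ⟨A, Or.inl rfl, Bᶜ, Or.inr rfl, Or.inl h⟩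
    · exact ⟨Aᶜ, Or.inr rfl, B, Or.inl rfl, Or.inl h⟩
    · exact ⟨Aᶜ, Or.inr rfl, Bᶜ, Or.inr rfl, Or.inl h⟩
  · intro l hl
    by_contra! hcon
    have h := hmin (y := L \ {l}) ⟨Set.sdiff_subset.trans hLN, fun i j hij => by
      obtain ⟨m, hm, hmd⟩ := hL i j hij
      by_cases hml : m = l
      · subst hml
        obtain ⟨m', hm', hmd', hne⟩ := hcon i j hmd
        exact ⟨m', ⟨hm', hne⟩, hmd'⟩
      · exact ⟨m, ⟨hm, hml⟩, hmd⟩⟩ Set.sdiff_subset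
    exact (h hl).2 rfl

namespace IsMinimalDistinguisher

variable {ι : Type*} {k : ι → ℕ} {P : ι → Set (Set V)} {L : Set (Set (Set V))}

theorem exists_effDist (hL : IsMinimalDistinguisher ord P L) (hc : ∀ A, ord Aᶜ = ord A) {A : Set V}
    (hA : A ∈ ⋃₀ L) : ∃ i j, EffDist ord A (P i) (P j) ∧
      ∀ m ∈ L, LineEffDist ord m (P i) (P j) → m = {A, Aᶜ} := by
  obtain ⟨i, j, ⟨B, hB, hBd⟩, huniq⟩ :=
    hL.exists_unique_line _ (pair_mem_of_mem_sUnion hL.isLine hA)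
  rcases pair_compl_eq_iff.1 hB with rfl | rfl
  · exact ⟨i, j, hBd, huniq⟩
  · exact ⟨j, i, hBd.symm hc, fun m hm hmd => huniq m hm (hmd.symm hc)⟩

/-- Lines that the profile `P i` does not orient lie behind a line that it does orient. -/
theorem isOrientation_home (hL : IsMinimalDistinguisher ord P L) (hc : ∀ A, ord Aᶜ = ord A)
    (hP : ∀ i, IsKProfile ord (k i) (P i)) (i : ι) :
    IsOrientation (⋃₀ L) (home L (P i)) ∧ IsConsistent (home L (P i)) := by
  have hcross : ∀ A ∈ home L (P i), ∀ B ∈ home L (P i), ¬ A ⊆ Bᶜ := by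
    rintro A ⟨-, A', hA', hA⟩ B ⟨-, B', hB', hB⟩ hAB
    exact (hP i).not_disjoint hc hA'.1 hB'.1
      (hA.trans (hAB.trans (Set.compl_subset_compl.2 hB)))
  have ho : IsOrientation (⋃₀ L) (home L (P i)) := by
    refine isOrientation_of (fun A => compl_mem_sUnion hL.isLine) (fun A hA => hA.1) ?_
      fun A hA hA' => hcross A hA _ hA' (compl_compl A).symm.subset
    intro B hB
    have hB' := compl_mem_sUnion hL.isLine hB
    rcases lt_or_ge (ord B) (k i) with hlt | hge
    · exact ((hP i).mem_or hlt).imp (fun h => subset_home ⟨h, hB⟩) fun h => subset_home ⟨h, hB'⟩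
    -- `B` distinguishes `P a` from `P b` efficiently, while a line of lower order has `P i` on one
    -- side, and both `P a` and `P b` on the other
    obtain ⟨a, b, hab, -⟩ := hL.exists_effDist hc hB
    have hBa := (hP a).ord_lt hab.1
    have hBb := (hP b).ord_lt hab.2.1
    rw [hc] at hBb
    have hia : i ≠ a := by rintro rfl; exact hge.not_gt hBa
    obtain ⟨m, hm, C, rfl, hC⟩ := hL.exists_line i a hia
    have hCL : C ∈ ⋃₀ L := ⟨_, hm, Or.inl rfl⟩
    have hlt : ord C < ord B := ((hP i).ord_lt hC.1).trans_le hge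
    have hCb : Cᶜ ∈ P b := by
      refine ((hP b).mem_or (hlt.trans hBb)).resolve_left fun h => ?_
      have := hab.2.2 Cᶜ hC.2.1 (by rwa [compl_compl])
      rw [hc] at this
      exact this.not_gt hlt
    rcases hL.isLaminar.nested hL.isLine hCL hB with h | h | h | h
    · exact Or.inl ⟨hB, C, ⟨hC.1, hCL⟩, h⟩
    · exact Or.inr ⟨hB', C, ⟨hC.1, hCL⟩, h⟩
    · exact ((hP b).compl_notMem ((hP b).mem_of_subset hCb h hBb) hab.2.1).elim
    · exact ((hP a).not_disjoint hc hC.2.1 hab.1 h).elim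
  exact ⟨ho, (isConsistent_iff hL.isLine ho).2 hcross⟩

/-- Every node of the tree is the home of some profile in the family.  If `O` were not, let `A` have
largest order in its splitting star: every two profiles efficiently distinguished by `{A, Aᶜ}` would
be efficiently distinguished by another line in the star as well. -/
theorem exists_home_eq [Finite V] [Nonempty ι] (hL : IsMinimalDistinguisher ord P L)
    (hc : ∀ A, ord Aᶜ = ord A) (hP : ∀ i, IsKProfile ord (k i) (P i)) {O : Set (Set V)}
    (hO : IsOrientation (⋃₀ L) O) (hOc : IsConsistent O) : ∃ i, home L (P i) = O := by
  rw [isConsistent_iff hL.isLine hO] at hOc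
  rcases O.eq_empty_or_nonempty with rfl | ⟨B, hB⟩
  · obtain ⟨i⟩ := ‹Nonempty ι›
    refine ⟨i, Set.eq_empty_of_forall_notMem fun A hA => ?_⟩
    exact (hO.mem_or hA.1).elim id id
  obtain ⟨A, hA, hmax⟩ := Set.Finite.exists_maximalFor ord (maximalElements O) (Set.toFinite _)
    (exists_maximalElements_subset hB |>.imp fun _ h => h.1)
  obtain ⟨i, j, hij, huniq⟩ := hL.exists_effDist hc (hO.subset hA.1)
  refine ⟨i, ?_⟩
  obtain ⟨hi, hic⟩ := hL.isOrientation_home hc hP i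
  have hcross := (isConsistent_iff hL.isLine hi).1 hic
  -- It suffices that the maximal elements of `O` lie in `home L (P i)`.
  suffices h : maximalElements O ⊆ home L (P i) by
    have hsub : O ⊆ home L (P i) := by
      intro C hC
      obtain ⟨D, hD, hDC⟩ := exists_maximalElements_subset hC
      obtain ⟨-, E, hE, hED⟩ := h hD
      exact ⟨hO.subset hC, E, hE, hED.trans hDC⟩
    refine Set.Subset.antisymm (fun C hC => ?_) hsub
    refine (hO.mem_or hC.1).resolve_right fun h' => ?_
    exact hcross C hC _ (hsub h') (compl_compl C).symm.subset
  -- Otherwise some maximal element `D ≠ A` also distinguishes `P i` from `P j` efficiently.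
  intro D hD
  by_contra hDi
  have hDL := hO.subset hD.1
  have hDA : D ≠ A := by rintro rfl; exact hDi (subset_home ⟨hij.1, hDL⟩)
  have hle : ord D ≤ ord A := (le_total (ord D) (ord A)).elim id fun h => hmax hD h
  have hDi' : Dᶜ ∈ P i := ((hP i).mem_or (hle.trans_lt ((hP i).ord_lt hij.1))).resolve_left
    fun h => hDi (subset_home ⟨h, hDL⟩)
  have hAD : Aᶜ ⊆ D := by
    rcases hL.isLaminar.nested hL.isLine (hO.subset hA.1) hDL with h | h | h | h
    · exact (hDA (hD.2 A hA.1 h).symm).elim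
    · exact (hOc A hA.1 D hD.1 h).elim
    · exact h
    · exact (hDA (hA.2 D hD.1 (Set.compl_subset_compl.1 h))).elim
  have hDj : D ∈ P j := (hP j).mem_of_subset hij.2.1 hAD
    (hle.trans_lt ((hc A).symm.trans_lt ((hP j).ord_lt hij.2.1)))
  have hDd : LineEffDist ord {D, Dᶜ} (P i) (P j) := by
    refine ⟨Dᶜ, by rw [compl_compl, Set.pair_comm], hDi', by rwa [compl_compl], fun E hE hE' => ?_⟩
    rw [hc]
    exact hle.trans (hij.2.2 E hE hE')
  rcases pair_compl_eq_iff.1 (huniq _ (pair_mem_of_mem_sUnion hL.isLine hDL) hDd) with h | h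
  · exact hDA h
  · exact hOc D hD.1 A hA.1 h.subset

/-- The end of the edge `{A, Aᶜ}` of the tree at which `A` is maximal: this line is oriented as `A`,
and every other line as the side that contains one of `A` and `Aᶜ`.  Replacing `A` by `Aᶜ` yields the
other end of the edge. -/
theorem isOrientation_end (hL : IsMinimalDistinguisher ord P L) {A : Set V} (hA : A ∈ ⋃₀ L) :
    IsOrientation (⋃₀ L) {B | B ∈ ⋃₀ L ∧ B ≠ Aᶜ ∧ (A ⊆ B ∨ Aᶜ ⊆ B)} ∧
      IsConsistent {B | B ∈ ⋃₀ L ∧ B ≠ Aᶜ ∧ (A ⊆ B ∨ Aᶜ ⊆ B)} := by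
  have hne := nonempty_of_mem_sUnion hL.isLine hA
  have hne' := nonempty_of_mem_sUnion hL.isLine (compl_mem_sUnion hL.isLine hA)
  have hcross : ∀ B ∈ {B | B ∈ ⋃₀ L ∧ B ≠ Aᶜ ∧ (A ⊆ B ∨ Aᶜ ⊆ B)},
      ∀ C ∈ {B | B ∈ ⋃₀ L ∧ B ≠ Aᶜ ∧ (A ⊆ B ∨ Aᶜ ⊆ B)}, ¬ B ⊆ Cᶜ := by
    rintro B ⟨-, hB, hB' | hB'⟩ C ⟨-, hC, hC' | hC'⟩ hBC
    · obtain ⟨x, hx⟩ := hne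
      exact hBC (hB' hx) (hC' hx)
    · refine hC (Set.Subset.antisymm ?_ hC')
      exact Set.subset_compl_comm.1 (hB'.trans hBC)
    · refine hB (Set.Subset.antisymm ?_ hB')
      exact hBC.trans (Set.compl_subset_compl.2 hC')
    · obtain ⟨x, hx⟩ := hne'
      exact hBC (hB' hx) (hC' hx)
  have ho : IsOrientation (⋃₀ L) {B | B ∈ ⋃₀ L ∧ B ≠ Aᶜ ∧ (A ⊆ B ∨ Aᶜ ⊆ B)} := by
    refine isOrientation_of (fun B => compl_mem_sUnion hL.isLine) (fun B hB => hB.1) ?_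
      fun B hB hB' => hcross B hB _ hB' (compl_compl B).symm.subset
    intro B hB
    have hB' := compl_mem_sUnion hL.isLine hB
    by_cases h1 : B = Aᶜ
    · right
      subst h1
      rw [compl_compl]
      exact ⟨hA, ne_compl_of_nonempty hne, Or.inl subset_rfl⟩
    by_cases h2 : B = A
    · subst h2
      exact Or.inl ⟨hA, h1, Or.inl subset_rfl⟩
    have h3 : Bᶜ ≠ Aᶜ := fun h => h2 (compl_injective h)
    rcases hL.isLaminar.nested hL.isLine hA hB with h | h | h | h
    · exact Or.inl ⟨hB, h1, Or.inl h⟩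
    · exact Or.inr ⟨hB', h3, Or.inl h⟩
    · exact Or.inl ⟨hB, h1, Or.inr h⟩
    · exact Or.inr ⟨hB', h3, Or.inr h⟩
  exact ⟨ho, (isConsistent_iff hL.isLine ho).2 hcross⟩

/-- Each line in `L` is the only one in `L` to distinguish the profiles living at its two ends. -/
theorem exists_only_line [Finite V] [Nonempty ι] (hL : IsMinimalDistinguisher ord P L)
    (hc : ∀ A, ord Aᶜ = ord A) (hP : ∀ i, IsKProfile ord (k i) (P i)) {l : Set (Set V)}
    (hl : l ∈ L) : ∃ i j, i ≠ j ∧ ∀ m ∈ L, Distinguishes m (P i) (P j) → m = l := by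
  obtain ⟨A, -, -, rfl⟩ := hL.isLine l hl
  have hA : A ∈ ⋃₀ L := ⟨_, hl, Or.inl rfl⟩
  have hA' : Aᶜ ∈ ⋃₀ L := ⟨_, hl, Or.inr rfl⟩
  obtain ⟨ho, hco⟩ := hL.isOrientation_end hA
  obtain ⟨ho', hco'⟩ := hL.isOrientation_end hA'
  obtain ⟨i, hi⟩ := hL.exists_home_eq hc hP ho hco
  obtain ⟨j, hj⟩ := hL.exists_home_eq hc hP ho' hco'
  have hneA := ne_compl_of_nonempty (nonempty_of_mem_sUnion hL.isLine hA)
  refine ⟨i, j, ?_, ?_⟩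
  · rintro rfl
    have h1 : A ∈ home L (P i) := by
      rw [hi]; exact ⟨hA, hneA, Or.inl subset_rfl⟩
    rw [hj] at h1
    exact h1.2.1 (compl_compl A).symm
  · rintro m hm ⟨B, rfl, hB, hB'⟩
    have hBL : B ∈ ⋃₀ L := ⟨_, hm, Or.inl rfl⟩
    have hBi : B ∈ home L (P i) := subset_home ⟨hB, hBL⟩
    have hBj : Bᶜ ∈ home L (P j) := subset_home ⟨hB', compl_mem_sUnion hL.isLine hBL⟩
    by_contra hne
    -- otherwise `B` lies at both ends, as these differ only in the line `{A, Aᶜ}`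
    have hBj' : B ∈ home L (P j) := by
      rw [hi] at hBi
      rw [hj]
      refine ⟨hBL, fun h => hne (pair_compl_eq_iff.2 (Or.inl (h.trans (compl_compl A)))), ?_⟩
      rw [compl_compl]
      exact hBi.2.2.symm
    obtain ⟨h1, h2⟩ := hL.isOrientation_home hc hP j
    exact (isConsistent_iff hL.isLine h1).1 h2 B hBj' _ hBj (compl_compl B).symm.subset

/-- The splitting stars of `L` are the sets of maximal elements of the partial orientations of `L`
by the profiles in the family. -/
theorem isSplittingStar_iff [Finite V] [Nonempty ι] (hL : IsMinimalDistinguisher ord P L)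
    (hc : ∀ A, ord Aᶜ = ord A) (hP : ∀ i, IsKProfile ord (k i) (P i)) {s : Set (Set V)} :
    IsSplittingStar L s ↔ ∃ i, s = maximalElements (P i ∩ ⋃₀ L) := by
  constructor
  · rintro ⟨O, hO, hOc, rfl⟩
    obtain ⟨i, rfl⟩ := hL.exists_home_eq hc hP hO hOc
    exact ⟨i, maximalElements_home L (P i)⟩
  · rintro ⟨i, rfl⟩
    obtain ⟨h1, h2⟩ := hL.isOrientation_home hc hP i
    exact ⟨_, h1, h2, (maximalElements_home L (P i)).symm⟩

end IsMinimalDistinguisher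

/-! ### The tree of regions for a submodular order function -/

/-- The theorem for an arbitrary symmetric and submodular order function. -/
theorem exists_laminar_lines [Finite V] (hc : ∀ A, ord Aᶜ = ord A)
    (hs : ∀ A B, ord (A ∩ B) + ord (A ∪ B) ≤ ord A + ord B)
    {R : Set (Set (Set (Set V)))} (hne : R.Nonempty) (hR : ∀ ρ ∈ R, IsRegion ord ρ)
    (hdist : ∀ ρ ∈ R, ∀ σ ∈ R, ρ ≠ σ → RegionsDistinguishable ρ σ) :
    ∃ L : Set (Set (Set V)),
      (∀ l ∈ L, IsLine l) ∧ IsLaminar L ∧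
      (∀ ρ ∈ R, ∀ σ ∈ R, ρ ≠ σ → ∃ l ∈ L, EfficientlySeparates ord l ρ σ) ∧
      (∀ L' : Set (Set (Set V)), L' ⊂ L →
        ¬ ∀ ρ ∈ R, ∀ σ ∈ R, ρ ≠ σ → ∃ l ∈ L', Separates l ρ σ) ∧
      {s | IsSplittingStar L s} = {s | ∃ ρ ∈ R, IsOutline ord L ρ s} := by
  choose k P hP using fun ρ : R => (hR ρ ρ.2).exists_leastProfile hc
  have : Nonempty R := hne.to_subtype
  have hkP := fun ρ => (hP ρ).isKProfile
  obtain ⟨L, hL⟩ := exists_isMinimalDistinguisher hc hs hkP fun ρ σ hρσ =>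
    (hP ρ).exists_mem_compl_mem hc (hP σ)
      (hdist ρ ρ.2 σ σ.2 fun h => hρσ (Subtype.ext h))
  refine ⟨L, hL.isLine, hL.isLaminar, ?_, ?_, ?_⟩
  · intro ρ hρ σ hσ hρσ
    obtain ⟨l, hl, A, rfl, hA⟩ := hL.exists_line ⟨ρ, hρ⟩ ⟨σ, hσ⟩ fun h => hρσ (Subtype.ext_iff.1 h)
    refine ⟨_, hl, ((hP ⟨ρ, hρ⟩).separates_iff (hP ⟨σ, hσ⟩)).2 ⟨A, rfl, hA.1, hA.2.1⟩, ?_⟩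
    intro m _ hm A' hA' B' hB'
    obtain ⟨B, rfl, hB1, hB2⟩ := ((hP ⟨ρ, hρ⟩).separates_iff (hP ⟨σ, hσ⟩)).1 hm
    have e1 : ord A' = ord A := by rcases hA' with rfl | rfl <;> simp [hc]
    have e2 : ord B' = ord B := by rcases hB' with rfl | rfl <;> simp [hc]
    rw [e1, e2]
    exact hA.2.2 B hB1 hB2
  · intro L' hL' hsep
    obtain ⟨l, hl, hl'⟩ := Set.exists_of_ssubset hL'
    obtain ⟨ρ, σ, hρσ, honly⟩ := hL.exists_only_line hc hkP hl
    obtain ⟨m, hm, hmsep⟩ := hsep ρ ρ.2 σ σ.2 fun h => hρσ (Subtype.ext h)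
    exact hl' (honly m (hL'.1 hm) (((hP ρ).separates_iff (hP σ)).1 hmsep) ▸ hm)
  · ext s
    simp only [Set.mem_ofPred_eq]
    rw [hL.isSplittingStar_iff hc hkP]
    constructor
    · rintro ⟨ρ, h⟩
      exact ⟨ρ, ρ.2, (hP ρ).isOutline_iff.2 h⟩
    · rintro ⟨ρ, hρ, h⟩
      exact ⟨⟨ρ, hρ⟩, (hP ⟨ρ, hρ⟩).isOutline_iff.1 h⟩

end Universe

/-! ### The order function of a picture -/

section Picture

variable {X : Type*} [TopologicalSpace X] {C : Set X} [Topology.CWComplex C] {n : ℕ}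

theorem boundary_compl (A : Set (Pixel C)) : boundary Aᶜ = boundary A := by
  ext e
  constructor
  · rintro ⟨p, q, h, hp, hq⟩
    exact ⟨q, p, ⟨h.1.symm, h.2.2, h.2.1⟩, not_not.1 hq, hp⟩
  · rintro ⟨p, q, h, hp, hq⟩
    exact ⟨q, p, ⟨h.1.symm, h.2.2, h.2.1⟩, hq, not_not.2 hp⟩

theorem mem_boundary_iff {A : Set (Pixel C)} {e : Edge C} :
    e ∈ boundary A ↔ (∃ p ∈ A, OnBoundary e p) ∧ ∃ q ∉ A, OnBoundary e q := by
  constructor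
  · rintro ⟨p, q, h, hp, hq⟩
    exact ⟨⟨p, hp, h.2.1⟩, q, hq, h.2.2⟩
  · rintro ⟨⟨p, hp, hep⟩, q, hq, heq⟩
    exact ⟨p, q, ⟨fun h => hq (h ▸ hp), hep, heq⟩, hp, hq⟩

theorem boundary_inter_union_subset (A B : Set (Pixel C)) :
    boundary (A ∩ B) ∪ boundary (A ∪ B) ⊆ boundary A ∪ boundary B := by
  rintro e (⟨p, q, h, hp, hq⟩ | ⟨p, q, h, hp, hq⟩)
  · by_cases hqA : q ∈ A
    · exact Or.inr ⟨p, q, h, hp.2, fun hqB => hq ⟨hqA, hqB⟩⟩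
    · exact Or.inl ⟨p, q, h, hp.1, hqA⟩
  · rcases hp with hp | hp
    · exact Or.inl ⟨p, q, h, hp, fun h' => hq (Or.inl h')⟩
    · exact Or.inr ⟨p, q, h, hp, fun h' => hq (Or.inr h')⟩

theorem boundary_inter_inter_subset (A B : Set (Pixel C)) :
    boundary (A ∩ B) ∩ boundary (A ∪ B) ⊆ boundary A ∩ boundary B := by
  rintro e ⟨h1, h2⟩
  obtain ⟨⟨p, hp, hep⟩, -⟩ := mem_boundary_iff.1 h1
  obtain ⟨-, q, hq, heq⟩ := mem_boundary_iff.1 h2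
  exact ⟨mem_boundary_iff.2 ⟨⟨p, hp.1, hep⟩, q, fun h => hq (Or.inl h), heq⟩,
    mem_boundary_iff.2 ⟨⟨p, hp.2, hep⟩, q, fun h => hq (Or.inr h), heq⟩⟩

theorem order_compl (ν : AddGroupNorm (Fin n → ZMod 2)) (N : ℤ) (pic : Pixel C → Fin n → ZMod 2)
    (A : Set (Pixel C)) : order ν N pic Aᶜ = order ν N pic A := by
  rw [order, order, boundary_compl]

theorem finsum_mem_le_of_subset {α : Type*} {f : α → ℝ} {s t : Set α} (hst : s ⊆ t)
    (ht : t.Finite) (hf : ∀ x ∈ t, 0 ≤ f x) : ∑ᶠ x ∈ s, f x ≤ ∑ᶠ x ∈ t, f x := by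
  rw [← finsum_mem_add_sdiff hst ht]
  exact le_add_of_nonneg_right (finsum_nonneg fun x => finsum_nonneg fun hx => hf x hx.1)

theorem order_submodular (hC : IsFlatSquareComplex C) [Finite (Pixel C)]
    (ν : AddGroupNorm (Fin n → ZMod 2)) (pic : Pixel C → Fin n → ZMod 2)
    (N : ℤ) (hN : ∀ (e : Edge C) (p q : Pixel C), Joins e p q → ν (pic q - pic p) ≤ N)
    (A B : Set (Pixel C)) :
    order ν N pic (A ∩ B) + order ν N pic (A ∪ B) ≤ order ν N pic A + order ν N pic B := by
  have hfin := boundary_finite hC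
  have hnonneg : ∀ D : Set (Pixel C), ∀ e ∈ boundary D, 0 ≤ (N : ℝ) - weight ν pic e := by
    rintro D e ⟨p, q, h, -, -⟩
    rw [weight_eq hC ν pic h]
    exact sub_nonneg.2 (hN e p q h)
  unfold order
  rw [← finsum_mem_union_inter (hfin (A ∩ B)) (hfin (A ∪ B)),
    ← finsum_mem_union_inter (hfin A) (hfin B)]
  refine add_le_add
    (finsum_mem_le_of_subset (boundary_inter_union_subset A B) ((hfin A).union (hfin B)) ?_)
    (finsum_mem_le_of_subset (boundary_inter_inter_subset A B) ((hfin A).inter_of_left _) ?_)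
  · rintro e (h | h)
    · exact hnonneg A e h
    · exact hnonneg B e h
  · exact fun e h => hnonneg A e h.1

end Picture

end PictureTangles

theorem theorem5 {X : Type*} [TopologicalSpace X] [T2Space X] (C : Set X) [Topology.CWComplex C]
    (hC : IsFlatSquareComplex C) [Finite (Pixel C)]
    (n : ℕ) (ν : AddGroupNorm (Fin n → ZMod 2)) (pic : Pixel C → Fin n → ZMod 2)
    (N : ℤ) (hN : ∀ (e : Edge C) (p q : Pixel C), Joins e p q → ν (pic q - pic p) ≤ N)
    (R : Set (Set (Set (Set (Pixel C))))) (hne : R.Nonempty)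
    (hR : ∀ ρ ∈ R, IsRegion (order ν N pic) ρ)
    (hdist : ∀ ρ ∈ R, ∀ σ ∈ R, ρ ≠ σ → RegionsDistinguishable ρ σ) :
    ∃ L : Set (Set (Set (Pixel C))),
      (∀ l ∈ L, IsLine l) ∧ IsLaminar L ∧
      (∀ ρ ∈ R, ∀ σ ∈ R, ρ ≠ σ → ∃ l ∈ L, EfficientlySeparates (order ν N pic) l ρ σ) ∧
      (∀ L' : Set (Set (Set (Pixel C))), L' ⊂ L →
        ¬ ∀ ρ ∈ R, ∀ σ ∈ R, ρ ≠ σ → ∃ l ∈ L', Separates l ρ σ) ∧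
      {s | IsSplittingStar L s} = {s | ∃ ρ ∈ R, IsOutline (order ν N pic) L ρ s} := by
  exact exists_laminar_lines (order_compl ν N pic) (order_submodular hC ν pic N hN) hne hR hdist
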